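/- Theorem. Let $\mathbf{k}$ be a commutative ring, let $n \ge 0$ be an integer, and let $\mathbf{k}[S_n]$ be the group algebra of the symmetric group $S_n$ of $\{1,\dots,n\}$ (with product $(\sigma\tau)(i)=\sigma(\tau(i))$). Let $w_0 \in S_n$ be the permutation $i \mapsto n+1-i$. The descent set of $w \in S_n$ is $\operatorname{Des} w = \{ i \in \{1,\dots,n-1\} : w(i) > w(i+1)\}$. For $I \subseteq \{1,\dots,n-1\}$ put $B_I = \sum_{w \in S_n,\ \operatorname{Des} w \subseteq I} w \in \mathbf{k}[S_n]$; the descent algebra $\Sigma_n$ is the $\mathbf{k}$-linear span of all the $B_I$. For a composition $\alpha = (\alpha_1,\dots,\alpha_p)$ of $n$ (a tuple of positive integers with sum $n$) put $B_\alpha = B_I$ with $I = \{\alpha_1+\cdots+\alpha_i : 1 \le i \le p-1\}$. A face is a tuple $F = (F_1,\dots,F_m)$ of nonempty, pairwise disjoint sets (its blocks) with union $\{1,\dots,n\}$; its length is $\ell(F) = m$ and its type is the composition $(|F_1|,\dots,|F_m|)$ of $n$. The knapsack number $n_\alpha(F)$ is the number of faces $G$ of type $\alpha$ such that every block of $F$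 is a subset of a block of $G$. The signed knapsack number is $\widetilde n_\alpha(F) = (-1)^{n-\ell(F)}\, n_\alpha(F) \in \mathbb{Z}$, and $\widetilde n_\alpha(\mathcal F) \subset \mathbb{Z}$ is the finite set of the signed knapsack numbers of all faces. Then, for every composition $\alpha$ of $n$, the elements $w_0 B_\alpha$ and $B_\alpha w_0$ belong to $\Sigma_n$, and $$\prod_{z \in \widetilde n_\alpha(\mathcal F)} (w_0 B_\alpha - z) = 0 \qquad\text{and}\qquad \prod_{z \in \widetilde n_\alpha(\mathcal F)} (B_\alpha w_0 - z) = 0 .$$ Equivalently, the polynomial $\prod_{z \in \widetilde n_\alpha(\mathcal F)} (x - z) \in \mathbf{k}[x]$ annihilates both elements. Each product has exactly one factor for each distinct integer $z \in \widetilde n_\alpha(\mathcal F)$, even if several faces share this signed knapsack number or if several of these integers have the same image in $\mathbf{k}$. -/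

import Mathlib

namespace ReverseShuffle

open Equiv

/-! Throughout, the set `{1, …, n}` is modelled by `Fin n`: the element `i : Fin n`, with underlying
natural number `0 ≤ i < n`, stands for `i + 1`. -/

/-! ### The descent algebra -/

/-- The descent set of a permutation `w` of `{1, …, n}`, as a subset of `{1, …, n - 1}`:
the position `i` (with `1 ≤ i ≤ n - 1`) is a descent iff `w(i) > w(i + 1)`. In `Fin n` the positions
`i` and `i + 1` have underlying values `i - 1` and `i`. -/
def descentSet {n : ℕ} (w : Perm (Fin n)) : Finset ℕ :=
  (Finset.Ico 1 n).filter fun i =>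
    ∃ h : i < n, w ⟨i, h⟩ < w ⟨i - 1, lt_of_le_of_lt (Nat.sub_le i 1) h⟩

/-- The subset `{α₁, α₁ + α₂, …, α₁ + ⋯ + α_{k-1}}` of `{1, …, n - 1}` that corresponds to the
composition `α = (α₁, …, α_k)` of `n`; the parts of `α` are the distances between consecutive
elements of this set with `0` and `n` added to it. -/
def partialSums {n : ℕ} (α : Composition n) : Finset ℕ :=
  (Finset.Ico 1 α.length).image α.sizeUpTo

/-- The element `B_I` of the group algebra: the sum of all permutations whose descent set is
contained in `I`. -/
noncomputable def basisBSet (k : Type*) [CommRing k] (n : ℕ) (I : Finset ℕ) :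
    MonoidAlgebra k (Perm (Fin n)) :=
  ∑ w : Perm (Fin n) with descentSet w ⊆ I, MonoidAlgebra.of k (Perm (Fin n)) w

/-- The element `B_α` of the group algebra, for a composition `α` of `n`. -/
noncomputable def basisB (k : Type*) [CommRing k] {n : ℕ} (α : Composition n) :
    MonoidAlgebra k (Perm (Fin n)) :=
  basisBSet k n (partialSums α)

/-- The descent algebra of the symmetric group: the `k`-linear span of the elements `B_I`
for `I ⊆ {1, …, n - 1}` inside the group algebra. -/
noncomputable def descentAlgebra (k : Type*) [CommRing k] (n : ℕ) :
    Submodule k (MonoidAlgebra k (Perm (Fin n))) :=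
  Submodule.span k {b | ∃ I ⊆ Finset.Ico 1 n, b = basisBSet k n I}

/-- The permutation with one-line notation `(n, n - 1, …, 1)`, as an element of the group
algebra. -/
noncomputable def longestWord (k : Type*) [CommRing k] (n : ℕ) :
    MonoidAlgebra k (Perm (Fin n)) :=
  MonoidAlgebra.of k (Perm (Fin n)) Fin.revPerm

/-! ### Set compositions and knapsack numbers -/

/-- A set composition, or face, of `{1, …, n}`: a tuple of nonempty, pairwise disjoint sets whose
union is the whole set. -/
@[ext]
structure Face (n : ℕ) where
  blocks : List (Finset (Fin n))
  nonempty : ∀ b ∈ blocks, b.Nonempty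
  disjoint : blocks.Pairwise Disjoint
  cover : ∀ i : Fin n, ∃ b ∈ blocks, i ∈ b
  deriving DecidableEq

namespace Face

variable {n : ℕ}

/-- The number of blocks. -/
def length (F : Face n) : ℕ := F.blocks.length

theorem nodup (F : Face n) : F.blocks.Nodup := by
  refine List.Pairwise.imp_of_mem ?_ F.disjoint
  intro a b ha _ hab h
  subst h
  exact (F.nonempty a ha).ne_empty (disjoint_self.mp hab)

instance : Fintype (Face n) :=
  Fintype.ofEquiv
    {l : {l : List (Finset (Fin n)) // l.Nodup} //
      (∀ b ∈ l.1, b.Nonempty) ∧ l.1.Pairwise Disjoint ∧ ∀ i : Fin n, ∃ b ∈ l.1, i ∈ b}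
    { toFun := fun l => ⟨l.1.1, l.2.1, l.2.2.1, l.2.2.2⟩
      invFun := fun F => ⟨⟨F.blocks, F.nodup⟩, F.nonempty, F.disjoint, F.cover⟩
      left_inv := fun _ => rfl
      right_inv := fun _ => rfl }

theorem sum_card_blocks (F : Face n) : (F.blocks.map Finset.card).sum = n := by
  have hd : (F.blocks.toFinset : Set (Finset (Fin n))).PairwiseDisjoint id := by
    intro a ha b hb hab
    have ha' : a ∈ F.blocks := by simpa using ha
    have hb' : b ∈ F.blocks := by simpa using hb
    exact F.disjoint.forall ha' hb' hab
  have hu : F.blocks.toFinset.biUnion id = Finset.univ := by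
    ext i
    simpa using F.cover i
  rw [← List.sum_toFinset _ F.nodup]
  have h := Finset.card_biUnion (s := F.blocks.toFinset) (t := id) hd
  rw [hu] at h
  simpa using h.symm

/-- The type of a face: the composition of `n` formed by the sizes of its blocks. -/
def type (F : Face n) : Composition n where
  blocks := F.blocks.map Finset.card
  blocks_pos := by
    intro i hi
    obtain ⟨b, hb, rfl⟩ := List.mem_map.mp hi
    exact (F.nonempty b hb).card_pos
  blocks_sum := F.sum_card_blocks

theorem length_le (F : Face n) : F.length ≤ n := by
  simpa [type, length, Composition.length] using F.type.length_le

/-- `F` is contained in `G` if every block of `F` is a subset of a block of `G`. -/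
def IsContained (F G : Face n) : Prop := ∀ b ∈ F.blocks, ∃ c ∈ G.blocks, b ⊆ c

instance (F G : Face n) : Decidable (F.IsContained G) :=
  inferInstanceAs (Decidable (∀ b ∈ F.blocks, ∃ c ∈ G.blocks, b ⊆ c))

end Face

/-- The knapsack number `n_α(F)`: the number of faces `G` of type `α` in which `F` is contained. -/
def knapsack {n : ℕ} (α : Composition n) (F : Face n) : ℕ :=
  (Finset.univ.filter fun G : Face n => F.IsContained G ∧ G.type = α).card

/-- The signed knapsack number `(-1)^(n - ℓ(F)) n_α(F)`; note that `ℓ(F) ≤ n` for every face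
(`Face.length_le`), so the subtraction of natural numbers is the true one. -/
def signedKnapsack {n : ℕ} (α : Composition n) (F : Face n) : ℤ :=
  (-1) ^ (n - F.length) * (knapsack α F : ℤ)

/-- The finite set of the distinct integers that are signed knapsack numbers of faces. -/
def signedKnapsackNumbers {n : ℕ} (α : Composition n) : Finset ℤ :=
  Finset.univ.image (signedKnapsack α)

/-- The polynomial `∏ (x - z)` over `k`, with one factor for each distinct integer `z` among the
signed knapsack numbers. -/
noncomputable def signedKnapsackPolynomial (k : Type*) [CommRing k] {n : ℕ} (α : Composition n) :
    Polynomial k :=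
  ∏ z ∈ signedKnapsackNumbers α, (Polynomial.X - Polynomial.C (z : k))

end ReverseShuffle

open ReverseShuffle

/-! Write U = {1, …, n-1} and N(J) = `constCount α.index J`, the knapsack number of the standard
face with breaks J; let ε = (-1)^|U∖J|. Solomon's rule gives B_α B_J = N(J) B_J plus terms B_K with
K ⊋ J and N(K) > N(J). Inclusion–exclusion gives w₀ B_J = ε B_J plus signed terms B_K with K ⊋ J,
where only N(K) ≥ N(J) is known. So w₀ B_α acts triangularly with eigenvalues ε N(J), but
triangularity alone would allow repeated factors.

To need each value only once, take v = B_J + ε w₀ B_J. Conjugation by w₀ reverses α and leaves N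
unchanged, so w₀ B_α w₀ B_J also has leading term N(J) B_J. Hence (w₀ B_α - ε N(J)) v involves only
terms B_K and w₀ B_K with N(K) > N(J), which by induction are killed by the product of the x - z
with |z| > N(J). On the other hand v = 2 B_J plus terms B_K with K ⊋ J, already killed by the
product over |z| ≥ N(J). So this product kills 2 B_J, and over ℤ it kills B_J
(`aeval_truncatedPolynomial_mul_basisBSet`). The case J = ∅, where B_∅ = 1, is the identity over ℤ;
it maps to every k, and conjugation by w₀ gives the second product. -/

namespace ReverseShuffle

open Equiv

/-! ### Descents and places where a function changes -/

section Descents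

variable {n : ℕ}

theorem descentSet_subset_Ico (w : Perm (Fin n)) : descentSet w ⊆ Finset.Ico 1 n :=
  Finset.filter_subset _ _

theorem succ_mem_descentSet {w : Perm (Fin n)} {i : ℕ} (h : i + 1 < n) :
    i + 1 ∈ descentSet w ↔ w ⟨i + 1, h⟩ < w ⟨i, i.lt_succ_self.trans h⟩ := by
  simp [descentSet, h]

theorem mem_Ico_one {i : ℕ} : i ∈ Finset.Ico 1 n ↔ ∃ j, i = j + 1 ∧ j + 1 < n := by
  rw [Finset.mem_Ico]
  constructor
  · rintro ⟨h1, h2⟩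
    exact ⟨i - 1, by omega, by omega⟩
  · rintro ⟨j, rfl, h⟩
    omega

theorem descentSet_subset_iff {w : Perm (Fin n)} {I : Finset ℕ} :
    descentSet w ⊆ I ↔
      ∀ i (h : i + 1 < n), i + 1 ∉ I → w ⟨i, i.lt_succ_self.trans h⟩ < w ⟨i + 1, h⟩ := by
  constructor
  · intro hw i h hi
    by_contra hlt
    refine hi (hw ((succ_mem_descentSet h).2 (lt_of_le_of_ne (not_lt.1 hlt) ?_)))
    intro he
    have := congrArg Fin.val (w.injective he)
    simp at this
  · intro hw i hi
    obtain ⟨j, rfl, hj⟩ := mem_Ico_one.1 (descentSet_subset_Ico w hi)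
    by_contra hn
    exact lt_asymm (hw j hj hn) ((succ_mem_descentSet hj).1 hi)

/-- The positions `i` at which a function takes different values at `i - 1` and `i`. -/
def changeSet {A : Type*} [DecidableEq A] (g : Fin n → A) : Finset ℕ :=
  (Finset.Ico 1 n).filter fun i =>
    ∃ h : i < n, g ⟨i, h⟩ ≠ g ⟨i - 1, lt_of_le_of_lt (Nat.sub_le i 1) h⟩

theorem changeSet_subset_Ico {A : Type*} [DecidableEq A] (g : Fin n → A) :
    changeSet g ⊆ Finset.Ico 1 n :=
  Finset.filter_subset _ _

theorem succ_mem_changeSet {A : Type*} [DecidableEq A] {g : Fin n → A} {i : ℕ} (h : i + 1 < n) :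
    i + 1 ∈ changeSet g ↔ g ⟨i, i.lt_succ_self.trans h⟩ ≠ g ⟨i + 1, h⟩ := by
  simp [changeSet, h, eq_comm]

theorem changeSet_subset_iff {A : Type*} [DecidableEq A] {g : Fin n → A} {I : Finset ℕ} :
    changeSet g ⊆ I ↔
      ∀ i (h : i + 1 < n), i + 1 ∉ I → g ⟨i, i.lt_succ_self.trans h⟩ = g ⟨i + 1, h⟩ := by
  constructor
  · intro hg i h hi
    by_contra hne
    exact hi (hg ((succ_mem_changeSet h).2 hne))
  · intro hg i hi
    obtain ⟨j, rfl, hj⟩ := mem_Ico_one.1 (changeSet_subset_Ico g hi)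
    by_contra hn
    exact (succ_mem_changeSet hj).1 hi (hg j hj hn)

/-- A permutation without descents inside the fibres of a monotone function is increasing on
each fibre. -/
theorem lt_of_descentSet_subset_changeSet {A : Type*} [LinearOrder A] {g : Fin n → A}
    (hg : Monotone g) {u : Perm (Fin n)} (hu : descentSet u ⊆ changeSet g) {i j : Fin n}
    (hij : i < j) (h : g i = g j) : u i < u j := by
  rw [descentSet_subset_iff] at hu
  obtain ⟨i, hi⟩ := i
  obtain ⟨j, hj⟩ := j
  replace hij : i + 1 ≤ j := by simpa using hij
  induction j, hij using Nat.le_induction with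
  | base =>
    exact hu i hj (by rw [succ_mem_changeSet hj]; simpa using h)
  | succ j hij ih =>
    have h1 : g ⟨i, hi⟩ ≤ g ⟨j, by omega⟩ := hg (by simp; omega)
    have h2 : g ⟨j, by omega⟩ ≤ g ⟨j + 1, hj⟩ := hg (by simp)
    have h3 : g ⟨i, hi⟩ = g ⟨j, by omega⟩ := le_antisymm h1 (h ▸ h2)
    exact (ih (by omega) h3).trans
      (hu j hj (by rw [succ_mem_changeSet hj]; simpa using h3.symm.trans h))

end Descents

/-! ### Solomon's product rule -/

section Product

variable {n : ℕ} {A : Type*} [LinearOrder A]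

/-- The function `g` is a rearrangement of `g₀` which is weakly increasing on each block of the
standard set composition with breaks `J`. -/
def IsMonotoneRearrangement (g₀ : Fin n → A) (J : Finset ℕ) (g : Fin n → A) : Prop :=
  (∃ σ : Perm (Fin n), g = g₀ ∘ σ) ∧
    ∀ i (h : i + 1 < n), i + 1 ∉ J → g ⟨i, i.lt_succ_self.trans h⟩ ≤ g ⟨i + 1, h⟩

open Classical in
/-- Solomon's product rule for the elements `B_I`. -/
theorem basisBSet_changeSet_mul [Fintype A] (k : Type*) [CommRing k] {g₀ : Fin n → A}
    (hg₀ : Monotone g₀) (J : Finset ℕ) :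
    basisBSet k n (changeSet g₀) * basisBSet k n J =
      ∑ g : Fin n → A with IsMonotoneRearrangement g₀ J g, basisBSet k n (J ∪ changeSet g) := by
  simp only [basisBSet]
  rw [Finset.sum_mul_sum, ← Finset.sum_product', Finset.sum_sigma']
  -- From g = g₀ ∘ v and w = uv one recovers u as the stable sort of g ∘ w⁻¹ = g₀ ∘ u⁻¹, because u
  -- is increasing on each fibre of g₀.
  refine Finset.sum_bij' (fun p _ => ⟨g₀ ∘ p.2, p.1 * p.2⟩)
    (fun q _ => (Tuple.sort (q.1 ∘ ⇑q.2⁻¹), (Tuple.sort (q.1 ∘ ⇑q.2⁻¹))⁻¹ * q.2)) ?_ ?_ ?_ ?_ ?_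
  · rintro ⟨u, v⟩ h
    simp only [Finset.mem_product, Finset.mem_filter, Finset.mem_univ, true_and] at h
    obtain ⟨hu, hv⟩ := h
    rw [descentSet_subset_iff] at hv
    simp only [Finset.mem_sigma, Finset.mem_filter, Finset.mem_univ, true_and]
    refine ⟨⟨⟨v, rfl⟩, fun i h hi => hg₀ (hv i h hi).le⟩, ?_⟩
    rw [descentSet_subset_iff]
    intro i h hi
    rw [Finset.mem_union, succ_mem_changeSet h] at hi
    push Not at hi
    exact lt_of_descentSet_subset_changeSet hg₀ hu (hv i h hi.1) hi.2
  · rintro ⟨g, w⟩ h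
    simp only [Finset.mem_sigma, Finset.mem_filter, Finset.mem_univ, true_and] at h
    obtain ⟨⟨⟨σ, rfl⟩, hg⟩, hw⟩ := h
    have hs : ((g₀ ∘ σ) ∘ ⇑w⁻¹) ∘ Tuple.sort ((g₀ ∘ σ) ∘ ⇑w⁻¹) = g₀ := by
      have h1 := Tuple.monotone_sort ((g₀ ∘ σ) ∘ ⇑w⁻¹)
      refine Tuple.unique_monotone (f := g₀) (σ := σ * w⁻¹ * Tuple.sort ((g₀ ∘ σ) ∘ ⇑w⁻¹)) (τ := 1)
        h1 hg₀
    have hst := (Tuple.eq_sort_iff.1 (rfl : Tuple.sort ((g₀ ∘ σ) ∘ ⇑w⁻¹) = _)).2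
    generalize Tuple.sort ((g₀ ∘ σ) ∘ ⇑w⁻¹) = u at hs hst
    have hu : descentSet u ⊆ changeSet g₀ := by
      rw [descentSet_subset_iff]
      intro i h hi
      rw [succ_mem_changeSet h, not_not] at hi
      refine hst _ _ (by simp) ?_
      have e1 := congrFun hs ⟨i, i.lt_succ_self.trans h⟩
      have e2 := congrFun hs ⟨i + 1, h⟩
      simp only [Function.comp_apply] at e1 e2 ⊢
      rw [e1, e2, hi]
    have hgv : ∀ x, g₀ ((u⁻¹ * w) x) = g₀ (σ x) := fun x => by
      have := congrFun hs ((u⁻¹ * w) x)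
      simpa using this.symm
    simp only [Finset.mem_product, Finset.mem_filter, Finset.mem_univ, true_and]
    refine ⟨hu, ?_⟩
    rw [descentSet_subset_iff] at hw ⊢
    intro i h hi
    have hle := hg i h hi
    -- A descent of v = u⁻¹w at a position outside J forces equal values of g₀ ∘ v there, so w
    -- increases at that position; but u is increasing on fibres of g₀, so w = uv would decrease.
    by_contra hlt
    rw [not_lt] at hlt
    have hle' := hg₀ hlt
    rw [hgv, hgv] at hle'
    have heq := le_antisymm hle hle'
    have hwi := hw i h (by
      rw [Finset.mem_union, succ_mem_changeSet h]
      push Not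
      exact ⟨hi, heq⟩)
    have hne : (u⁻¹ * w) ⟨i + 1, h⟩ ≠ (u⁻¹ * w) ⟨i, i.lt_succ_self.trans h⟩ := fun he => by
      have := congrArg Fin.val ((u⁻¹ * w).injective he)
      simp at this
    have := lt_of_descentSet_subset_changeSet hg₀ hu (lt_of_le_of_ne hlt hne)
      (by rw [hgv, hgv]; exact heq.symm)
    simp at this
    exact lt_asymm this hwi
  · rintro ⟨u, v⟩ h
    simp only [Finset.mem_product, Finset.mem_filter, Finset.mem_univ, true_and] at h
    have hs : u = Tuple.sort ((g₀ ∘ v) ∘ ⇑(u * v)⁻¹) := by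
      have he : (g₀ ∘ v) ∘ ⇑(u * v)⁻¹ = g₀ ∘ ⇑u⁻¹ := by
        ext x
        simp [mul_inv_rev]
      rw [he, Tuple.eq_sort_iff]
      refine ⟨?_, fun i j hij hf => ?_⟩
      · have : (g₀ ∘ ⇑u⁻¹) ∘ u = g₀ := by
          ext x
          simp
        rwa [this]
      · simp at hf
        exact lt_of_descentSet_subset_changeSet hg₀ h.1 hij hf
    simp only [← hs]
    simp
  · rintro ⟨g, w⟩ h
    simp only [Finset.mem_sigma, Finset.mem_filter, Finset.mem_univ, true_and] at h
    obtain ⟨⟨⟨σ, rfl⟩, hg⟩, hw⟩ := h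
    have hs : ((g₀ ∘ σ) ∘ ⇑w⁻¹) ∘ Tuple.sort ((g₀ ∘ σ) ∘ ⇑w⁻¹) = g₀ := by
      have h1 := Tuple.monotone_sort ((g₀ ∘ σ) ∘ ⇑w⁻¹)
      refine Tuple.unique_monotone (f := g₀) (σ := σ * w⁻¹ * Tuple.sort ((g₀ ∘ σ) ∘ ⇑w⁻¹)) (τ := 1)
        h1 hg₀
    dsimp only
    generalize Tuple.sort ((g₀ ∘ σ) ∘ ⇑w⁻¹) = u at hs
    have hgv : g₀ ∘ ⇑(u⁻¹ * w) = g₀ ∘ σ := by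
      ext x
      have := congrFun hs ((u⁻¹ * w) x)
      simpa using this.symm
    rw [hgv, mul_inv_cancel_left]
  · rintro ⟨u, v⟩ h
    simp

end Product

/-! ### Multiplication by w₀ -/

section LongestWord

variable {n : ℕ}

theorem longestWord_mul_self (k : Type*) [CommRing k] (n : ℕ) :
    longestWord k n * longestWord k n = 1 := by
  rw [longestWord, ← map_mul, ← map_one (MonoidAlgebra.of k (Perm (Fin n)))]
  congr 1
  ext x
  simp

theorem basisBSet_empty (k : Type*) [CommRing k] (n : ℕ) : basisBSet k n ∅ = 1 := by
  have h : (Finset.univ.filter fun w : Perm (Fin n) => descentSet w ⊆ ∅) = {1} := by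
    ext w
    simp only [Finset.mem_filter, Finset.mem_univ, true_and, Finset.mem_singleton]
    rw [descentSet_subset_iff]
    constructor
    · intro hw
      have hm : StrictMono w := by
        rintro ⟨i, hi⟩ ⟨j, hj⟩ hij
        replace hij : i + 1 ≤ j := by simpa using hij
        induction j, hij using Nat.le_induction with
        | base => exact hw i hj (by simp)
        | succ j hij ih => exact (ih (by omega)).trans (hw j hj (by simp))
      ext x
      have := Subsingleton.elim (hm.orderIsoOfSurjective w w.surjective) (OrderIso.refl _)
      exact congrArg Fin.val (DFunLike.congr_fun this x)
    · rintro rfl i h -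
      simp
  rw [basisBSet, h, Finset.sum_singleton, map_one]

/-- Left multiplication by w₀ complements descent sets; inclusion–exclusion turns the resulting
condition U∖Des w ⊆ J back into upper bounds on Des w. Every index U∖L contains U ∩ J, with equality
only for L = U∖J, which is the source of triangularity. -/
theorem longestWord_mul_basisBSet (k : Type*) [CommRing k] (J : Finset ℕ) :
    longestWord k n * basisBSet k n J =
      ∑ L ∈ (Finset.Ico 1 n \ J).powerset, (-1) ^ L.card * basisBSet k n (Finset.Ico 1 n \ L) := by
  have hd : ∀ w : Perm (Fin n),
      descentSet (Fin.revPerm * w) = Finset.Ico 1 n \ descentSet w := by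
    intro w
    ext i
    by_cases hi : i ∈ Finset.Ico 1 n
    · obtain ⟨j, rfl, hj⟩ := mem_Ico_one.1 hi
      rw [Finset.mem_sdiff, succ_mem_descentSet hj, succ_mem_descentSet hj]
      simp only [hi, true_and, Perm.mul_apply, Fin.revPerm_apply, Fin.rev_lt_rev, not_lt]
      refine ⟨le_of_lt, fun h => lt_of_le_of_ne h fun he => ?_⟩
      have := congrArg Fin.val (w.injective he)
      simp at this
    · refine iff_of_false (fun h => hi (descentSet_subset_Ico _ h)) ?_
      simp [hi]
  have h1 : longestWord k n * basisBSet k n J =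
      ∑ w : Perm (Fin n) with Finset.Ico 1 n \ descentSet w ⊆ J, MonoidAlgebra.of k _ w := by
    rw [longestWord, basisBSet, Finset.mul_sum]
    refine Finset.sum_bij' (fun w _ => Fin.revPerm * w) (fun w _ => Fin.revPerm * w) ?_ ?_ ?_ ?_ ?_
    · intro w hw
      rw [Finset.mem_filter, hd, Finset.sdiff_sdiff_eq_self (descentSet_subset_Ico w)]
      simpa using hw
    · intro w hw
      simpa [hd] using hw
    · intro w _
      ext x
      simp
    · intro w _
      ext x
      simp
    · intro w _
      rw [map_mul]
  rw [h1]
  simp only [basisBSet, Finset.mul_sum, Finset.sum_filter]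
  rw [Finset.sum_comm]
  refine Finset.sum_congr rfl fun w _ => ?_
  have h2 : ∀ L ∈ (Finset.Ico 1 n \ J).powerset,
      (-1) ^ L.card * (if descentSet w ⊆ Finset.Ico 1 n \ L then
        MonoidAlgebra.of k (Perm (Fin n)) w else 0) =
      (if L ∈ ((Finset.Ico 1 n \ J) \ descentSet w).powerset then (-1) ^ L.card else 0) *
        MonoidAlgebra.of k (Perm (Fin n)) w := by
    intro L hL
    rw [Finset.mem_powerset] at hL
    have : descentSet w ⊆ Finset.Ico 1 n \ L ↔
        L ∈ ((Finset.Ico 1 n \ J) \ descentSet w).powerset := by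
      rw [Finset.mem_powerset, Finset.subset_sdiff, Finset.subset_sdiff, disjoint_comm]
      simp [hL, descentSet_subset_Ico]
    simp only [this, ite_mul, zero_mul, mul_ite, mul_zero]
  rw [Finset.sum_congr rfl h2, ← Finset.sum_mul, ← Finset.sum_filter, Finset.filter_mem_eq_inter,
    Finset.inter_eq_right.2 (Finset.powerset_mono.2 Finset.sdiff_subset)]
  -- The coefficient of w is an alternating sum over a full power set, so it is 1 or 0 according to
  -- whether (U∖J)∖Des w is empty.
  have h3 := congrArg (Int.cast : ℤ → MonoidAlgebra k (Perm (Fin n)))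
    (Finset.sum_powerset_neg_one_pow_card (x := (Finset.Ico 1 n \ J) \ descentSet w))
  push_cast at h3
  have h4 : (Finset.Ico 1 n \ J) \ descentSet w = ∅ ↔ Finset.Ico 1 n \ descentSet w ⊆ J := by
    rw [sdiff_right_comm, Finset.sdiff_eq_empty_iff_subset]
  simp only [h3, h4]
  split_ifs <;> simp

/-- The reversal `i ↦ n - i` of a subset of `{1, …, n - 1}`. -/
def reverseSet (n : ℕ) (I : Finset ℕ) : Finset ℕ :=
  (Finset.Ico 1 n).filter fun i => n - i ∈ I

/-- Reversing both positions and values moves a descent from i to n - i. Thus w₀ B_α w₀ is again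
subject to the product rule. -/
theorem longestWord_mul_basisBSet_mul_longestWord (k : Type*) [CommRing k] (I : Finset ℕ) :
    longestWord k n * basisBSet k n I * longestWord k n = basisBSet k n (reverseSet n I) := by
  have hd : ∀ (w : Perm (Fin n)) i, i ∈ Finset.Ico 1 n →
      (i ∈ descentSet (Fin.revPerm * w * Fin.revPerm) ↔ n - i ∈ descentSet w) := by
    intro w i hi
    obtain ⟨j, rfl, hj⟩ := mem_Ico_one.1 hi
    obtain ⟨m, rfl⟩ : ∃ m, n = m + 1 + (j + 1) := ⟨n - (j + 2), by omega⟩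
    rw [Nat.add_sub_cancel, succ_mem_descentSet hj, succ_mem_descentSet (by omega)]
    simp only [Perm.mul_apply, Fin.revPerm_apply, Fin.rev_lt_rev]
    rw [iff_iff_eq]
    congr 2 <;> · ext; simp [Fin.val_rev]; try omega
  have hs : ∀ w : Perm (Fin n), descentSet (Fin.revPerm * w * Fin.revPerm) ⊆ reverseSet n I ↔
      descentSet w ⊆ I := by
    intro w
    constructor
    · intro h i hi
      have hi' := descentSet_subset_Ico _ hi
      have hi'' : n - i ∈ Finset.Ico 1 n := by rw [Finset.mem_Ico] at *; omega
      have he : n - (n - i) = i := by rw [Finset.mem_Ico] at *; omega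
      have := h ((hd w (n - i) hi'').2 (by rwa [he]))
      rw [reverseSet, Finset.mem_filter, he] at this
      exact this.2
    · intro h i hi
      have hi' := descentSet_subset_Ico _ hi
      exact Finset.mem_filter.2 ⟨hi', h ((hd w i hi').1 hi)⟩
  have hr : ∀ w : Perm (Fin n), Fin.revPerm * (Fin.revPerm * w * Fin.revPerm) * Fin.revPerm = w := by
    intro w
    ext x
    simp
  rw [longestWord, basisBSet, basisBSet, Finset.mul_sum, Finset.sum_mul]
  refine Finset.sum_bij' (fun w _ => Fin.revPerm * w * Fin.revPerm)
    (fun w _ => Fin.revPerm * w * Fin.revPerm) ?_ ?_ ?_ ?_ ?_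
  · intro w hw
    simpa [hs] using hw
  · intro w hw
    have := hs (Fin.revPerm * w * Fin.revPerm)
    rw [hr] at this
    simpa [this] using hw
  · intro w _
    exact hr w
  · intro w _
    exact hr w
  · intro w _
    rw [map_mul, map_mul]

end LongestWord

end ReverseShuffle

namespace ReverseShuffle

open Equiv

/-! ### Counting block-constant rearrangements -/

section Counting

variable {n : ℕ}

/-- The number of rearrangements of `g₀` that are constant on each block of the standard set
composition with breaks `J`. -/
def constCount {A : Type*} [Fintype A] [DecidableEq A] (g₀ : Fin n → A) (J : Finset ℕ) : ℕ :=
  (Finset.univ.filter fun g : Fin n → A =>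
    (∃ σ : Perm (Fin n), g = g₀ ∘ σ) ∧ changeSet g ⊆ J).card

theorem constCount_mono {A : Type*} [Fintype A] [DecidableEq A] (g₀ : Fin n → A) {J K : Finset ℕ} (h : J ⊆ K) :
    constCount g₀ J ≤ constCount g₀ K := by
  refine Finset.card_le_card fun g hg => ?_
  simp only [Finset.mem_filter, Finset.mem_univ, true_and] at hg ⊢
  exact ⟨hg.1, hg.2.trans h⟩

/-- The function g itself is counted only on the right. This strictness holds for the product-rule
terms, not for those in the expansion of w₀ B_J. -/
theorem constCount_lt {A : Type*} [Fintype A] [DecidableEq A] {g₀ g : Fin n → A} {J : Finset ℕ}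
    (hg : ∃ σ : Perm (Fin n), g = g₀ ∘ σ) (hJ : ¬ changeSet g ⊆ J) :
    constCount g₀ J < constCount g₀ (J ∪ changeSet g) := by
  refine Finset.card_lt_card (Finset.ssubset_iff_of_subset (fun f hf => ?_) |>.2 ⟨g, ?_, ?_⟩)
  · simp only [Finset.mem_filter, Finset.mem_univ, true_and] at hf ⊢
    exact ⟨hf.1, hf.2.trans Finset.subset_union_left⟩
  · simp only [Finset.mem_filter, Finset.mem_univ, true_and]
    refine ⟨hg, ?_⟩
    convert Finset.subset_union_right
  · simp only [Finset.mem_filter, Finset.mem_univ, true_and, not_and]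
    intro _ h
    exact hJ (by convert h)

theorem changeSet_comp_of_injective {A B : Type*} [DecidableEq A] [DecidableEq B] {f : A → B}
    (hf : Function.Injective f) (g : Fin n → A) : changeSet (f ∘ g) = changeSet g := by
  simp [changeSet, hf.eq_iff]

/-- Relabelling values does not move the changes, and the inner reversal is absorbed into the
permutation. -/
theorem constCount_rev {q : ℕ} (g₀ : Fin n → Fin q) (J : Finset ℕ) :
    constCount (Fin.rev ∘ g₀ ∘ Fin.rev) J = constCount g₀ J := by
  refine Finset.card_bij' (fun g _ => Fin.rev ∘ g) (fun g _ => Fin.rev ∘ g) ?_ ?_ ?_ ?_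
  · intro g hg
    simp only [Finset.mem_filter, Finset.mem_univ, true_and] at hg ⊢
    obtain ⟨⟨σ, rfl⟩, h⟩ := hg
    refine ⟨⟨Fin.revPerm * σ, ?_⟩, ?_⟩
    · ext x
      simp
    · convert h using 1
      convert changeSet_comp_of_injective Fin.rev_injective _
  · intro g hg
    simp only [Finset.mem_filter, Finset.mem_univ, true_and] at hg ⊢
    obtain ⟨⟨σ, rfl⟩, h⟩ := hg
    refine ⟨⟨Fin.revPerm * σ, ?_⟩, ?_⟩
    · ext x
      simp
    · convert h using 1
      convert changeSet_comp_of_injective Fin.rev_injective _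
  · intro g _
    ext x
    simp
  · intro g _
    ext x
    simp

theorem changeSet_rev {q : ℕ} (g₀ : Fin n → Fin q) :
    changeSet (Fin.rev ∘ g₀ ∘ Fin.rev) = reverseSet n (changeSet g₀) := by
  rw [changeSet_comp_of_injective Fin.rev_injective]
  ext i
  by_cases hi : i ∈ Finset.Ico 1 n
  · obtain ⟨j, rfl, hj⟩ := mem_Ico_one.1 hi
    obtain ⟨m, rfl⟩ : ∃ m, n = m + 1 + (j + 1) := ⟨n - (j + 2), by omega⟩
    rw [reverseSet, Finset.mem_filter, Nat.add_sub_cancel, succ_mem_changeSet hj,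
      succ_mem_changeSet (by omega)]
    simp only [hi, true_and, Function.comp_apply]
    rw [ne_comm, iff_iff_eq]
    congr 2 <;> · ext; simp [Fin.val_rev]; try omega
  · refine iff_of_false (fun h => hi (changeSet_subset_Ico _ h)) ?_
    simp [reverseSet, hi]

theorem index_eq_iff (α : Composition n) (j : Fin n) (a : Fin α.length) :
    α.index j = a ↔ α.sizeUpTo a ≤ j ∧ (j : ℕ) < α.sizeUpTo (a + 1) := by
  rw [eq_comm, ← Composition.mem_range_embedding_iff', Composition.mem_range_embedding_iff]

theorem monotone_index (α : Composition n) : Monotone α.index := by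
  intro i j hij
  by_contra! h
  have h1 := (index_eq_iff α i _).1 rfl
  have h2 := (index_eq_iff α j _).1 rfl
  have h3 : α.sizeUpTo (α.index j + 1) ≤ α.sizeUpTo (α.index i) :=
    α.monotone_sizeUpTo (Nat.succ_le_of_lt h)
  have h4 : (i : ℕ) ≤ j := hij
  omega

theorem partialSums_eq_changeSet (α : Composition n) : partialSums α = changeSet α.index := by
  ext i
  rw [partialSums, Finset.mem_image]
  constructor
  · rintro ⟨a, ha, rfl⟩
    rw [Finset.mem_Ico] at ha
    have h1 : α.sizeUpTo 0 < α.sizeUpTo a := by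
      have e := α.sizeUpTo_strict_mono (i := 0) (by omega)
      exact e.trans_le (α.monotone_sizeUpTo ha.1)
    have h2 : α.sizeUpTo a < n := by
      have e := α.sizeUpTo_strict_mono (i := a) ha.2
      exact e.trans_le (α.sizeUpTo_le _)
    rw [α.sizeUpTo_zero] at h1
    obtain ⟨j, hj⟩ : ∃ j, α.sizeUpTo a = j + 1 := ⟨α.sizeUpTo a - 1, by omega⟩
    have hjn : j + 1 < n := hj ▸ h2
    rw [hj, succ_mem_changeSet hjn]
    have h3 : α.index ⟨j + 1, hjn⟩ = ⟨a, ha.2⟩ := by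
      rw [index_eq_iff]
      exact ⟨hj.le, by simpa [← hj] using α.sizeUpTo_strict_mono ha.2⟩
    rw [h3]
    intro h
    have := ((index_eq_iff α _ _).1 h).1
    simp only [hj] at this
    omega
  · intro hi
    obtain ⟨j, rfl, hj⟩ := mem_Ico_one.1 (changeSet_subset_Ico _ hi)
    rw [succ_mem_changeSet hj] at hi
    obtain ⟨h1, h2⟩ := (index_eq_iff α ⟨j + 1, hj⟩ _).1 rfl
    have h3 : ¬ α.sizeUpTo (α.index ⟨j + 1, hj⟩) ≤ j := fun h =>
      hi ((index_eq_iff α _ _).2 ⟨h, lt_trans (by simp) h2⟩)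
    simp only at h1
    refine ⟨α.index ⟨j + 1, hj⟩, ?_, by omega⟩
    rw [Finset.mem_Ico]
    refine ⟨Nat.pos_of_ne_zero fun h0 => h3 ?_, (α.index ⟨j + 1, hj⟩).2⟩
    rw [h0, α.sizeUpTo_zero]
    exact Nat.zero_le _

theorem card_fiber_index (α : Composition n) (a : Fin α.length) :
    (Finset.univ.filter fun j => α.index j = a).card = α.blocksFun a := by
  have h : (Finset.univ.filter fun j => α.index j = a) = Finset.univ.map (α.embedding a).toEmbedding := by
    ext j
    simp only [Finset.mem_filter, Finset.mem_univ, true_and, Finset.mem_map]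
    rw [eq_comm, ← Composition.mem_range_embedding_iff']
    simp
  rw [h, Finset.card_map, Finset.card_univ, Fintype.card_fin]

/-- Bijections between corresponding fibres glue to a permutation. -/
theorem exists_perm_comp_eq_iff {A : Type*} [DecidableEq A] {f g : Fin n → A} :
    (∃ σ : Perm (Fin n), g = f ∘ σ) ↔
      ∀ a, (Finset.univ.filter fun j => g j = a).card = (Finset.univ.filter fun j => f j = a).card := by
  constructor
  · rintro ⟨σ, rfl⟩ a
    refine Finset.card_bij (fun j _ => σ j) ?_ (fun _ _ _ _ h => σ.injective h) ?_
    · intro j hj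
      simpa using hj
    · intro j hj
      exact ⟨σ.symm j, by simpa using hj, by simp⟩
  · intro h
    have e : ∀ a, Nonempty ({j // g j = a} ≃ {j // f j = a}) := fun a => by
      rw [← Fintype.card_eq, Fintype.card_subtype, Fintype.card_subtype]
      exact h a
    exact ⟨Equiv.ofFiberEquiv fun a => (e a).some, funext fun j => (Equiv.ofFiberEquiv_map _ j).symm⟩

end Counting

/-! ### Knapsack numbers of standard faces -/

section Faces

variable {n : ℕ}

/-- The face whose blocks are the fibres of a map, listed in a given order. -/
def Face.ofKey {K : Type*} [DecidableEq K] (l : List K) (key : Fin n → K) (hl : l.Nodup)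
    (hmem : ∀ i, key i ∈ l) (hsurj : ∀ s ∈ l, ∃ i, key i = s) : Face n where
  blocks := l.map fun s => Finset.univ.filter fun i => key i = s
  nonempty := by
    intro b hb
    obtain ⟨s, hs, rfl⟩ := List.mem_map.1 hb
    obtain ⟨i, hi⟩ := hsurj s hs
    exact ⟨i, by simpa using hi⟩
  disjoint := by
    rw [List.pairwise_map]
    refine hl.imp fun {s t} hst => ?_
    rw [Finset.disjoint_left]
    intro i hi hi'
    simp only [Finset.mem_filter, Finset.mem_univ, true_and] at hi hi'
    exact hst (hi.symm.trans hi')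
  cover := fun i => ⟨_, List.mem_map.2 ⟨key i, hmem i, rfl⟩, by simp⟩

/-- The first position of the block containing position `i`, for the breaks `J`. -/
def blockStart (J : Finset ℕ) : ℕ → ℕ
  | 0 => 0
  | i + 1 => if i + 1 ∈ J then i + 1 else blockStart J i

theorem blockStart_mem (J : Finset ℕ) (i : ℕ) : blockStart J i ∈ insert 0 J := by
  induction i with
  | zero => simp [blockStart]
  | succ i ih =>
    rw [blockStart]
    split_ifs with h
    · exact Finset.mem_insert_of_mem h
    · exact ih

theorem blockStart_eq_self {J : Finset ℕ} {i : ℕ} (h : i ∈ insert 0 J) : blockStart J i = i := by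
  cases i with
  | zero => rfl
  | succ i =>
    rw [blockStart, if_pos (by simpa using h)]

theorem blockStart_le (J : Finset ℕ) (i : ℕ) : blockStart J i ≤ i := by
  induction i with
  | zero => simp [blockStart]
  | succ i ih =>
    rw [blockStart]
    split_ifs <;> omega

/-- A function is constant on the blocks with breaks `J` iff it only changes at elements of `J`. -/
theorem changeSet_subset_iff_blockStart {A : Type*} [DecidableEq A] {g : Fin n → A}
    {J : Finset ℕ} :
    changeSet g ⊆ J ↔ ∀ i j : Fin n, blockStart J i = blockStart J j → g i = g j := by
  rw [changeSet_subset_iff]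
  constructor
  · intro h
    have hs : ∀ i (hi : i < n), g ⟨i, hi⟩ = g ⟨blockStart J i, (blockStart_le J i).trans_lt hi⟩ := by
      intro i
      induction i with
      | zero => intro hi; rfl
      | succ i ih =>
        intro hi
        by_cases hJ : i + 1 ∈ J
        · simp [blockStart_eq_self (Finset.mem_insert_of_mem hJ)]
        · rw [← h i hi hJ, ih]
          simp [blockStart, hJ]
    intro i j hij
    rw [← Fin.eta i i.2, ← Fin.eta j j.2, hs i i.2, hs j j.2]
    simp only [hij]
  · intro h i hi hJ
    exact h _ _ (by simp [blockStart, hJ])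

/-- The standard face with breaks `J`. -/
def standardFace (hn : 0 < n) (J : Finset ℕ) (hJ : J ⊆ Finset.Ico 1 n) : Face n :=
  Face.ofKey ((insert 0 J).sort (· ≤ ·)) (fun i => blockStart J i) (Finset.sort_nodup _ _)
    (fun i => by simpa using blockStart_mem J i)
    (fun s hs => by
      rw [Finset.mem_sort] at hs
      have hsn : s < n := by
        rcases Finset.mem_insert.1 hs with rfl | h
        · exact hn
        · exact (Finset.mem_Ico.1 (hJ h)).2
      exact ⟨⟨s, hsn⟩, blockStart_eq_self hs⟩)

theorem length_standardFace (hn : 0 < n) (J : Finset ℕ) (hJ : J ⊆ Finset.Ico 1 n) :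
    (standardFace hn J hJ).length = J.card + 1 := by
  have h0 : 0 ∉ J := fun h => by simpa using hJ h
  simp [standardFace, Face.ofKey, Face.length, Finset.card_insert_of_notMem h0]

theorem standardFace_isContained_iff (hn : 0 < n) (J : Finset ℕ) (hJ : J ⊆ Finset.Ico 1 n)
    (G : Face n) : (standardFace hn J hJ).IsContained G ↔
      ∀ i : Fin n, ∃ c ∈ G.blocks, ∀ j : Fin n, blockStart J j = blockStart J i → j ∈ c := by
  constructor
  · intro h i
    obtain ⟨c, hc, hs⟩ := h _ (List.mem_map.2 ⟨blockStart J i, by simpa using blockStart_mem J i, rfl⟩)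
    exact ⟨c, hc, fun j hj => hs (by simpa using hj)⟩
  · intro h b hb
    obtain ⟨s, hs, rfl⟩ := List.mem_map.1 hb
    obtain ⟨i, hi⟩ : ∃ i : Fin n, blockStart J i = s := by
      rw [Finset.mem_sort] at hs
      have hsn : s < n := by
        rcases Finset.mem_insert.1 hs with rfl | h
        · exact hn
        · exact (Finset.mem_Ico.1 (hJ h)).2
      exact ⟨⟨s, hsn⟩, blockStart_eq_self hs⟩
    obtain ⟨c, hc, hs⟩ := h i
    refine ⟨c, hc, fun j hj => hs j ?_⟩
    simp only [Finset.mem_filter, Finset.mem_univ, true_and] at hj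
    rw [hj, hi]

/-- A map g corresponds to the ordered list of its fibres: being a rearrangement of `α.index` fixes
the type, and constancy on the blocks of J is containment. -/
theorem knapsack_standardFace (α : Composition n) (hn : 0 < n) (J : Finset ℕ)
    (hJ : J ⊆ Finset.Ico 1 n) :
    knapsack α (standardFace hn J hJ) = constCount α.index J := by
  symm
  rw [constCount, knapsack]
  have hsurj : ∀ g : Fin n → Fin α.length, (∃ σ : Perm (Fin n), g = α.index ∘ σ) →
      ∀ a, ∃ i, g i = a := by
    rintro g ⟨σ, rfl⟩ a
    refine ⟨σ.symm (α.embedding a ⟨0, α.blocks_pos' a a.2⟩), ?_⟩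
    rw [Function.comp_apply, Equiv.apply_symm_apply, Composition.index_embedding]
  set S := Finset.univ.filter fun g : Fin n → Fin α.length =>
    (∃ σ : Perm (Fin n), g = α.index ∘ σ) ∧ changeSet g ⊆ J with hS
  have hsurj' : ∀ g ∈ S, ∀ a ∈ List.finRange α.length, ∃ i, g i = a := fun g hg a _ =>
    hsurj g (Finset.mem_filter.1 hg).2.1 a
  refine Finset.card_bij (s := S) (fun g hg => Face.ofKey (List.finRange α.length) g
    (List.nodup_finRange _) (fun _ => List.mem_finRange _) (hsurj' g hg)) ?_ ?_ ?_
  · intro g hg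
    rw [hS, Finset.mem_filter] at hg
    rw [Finset.mem_filter]
    obtain ⟨-, hg, hc⟩ := hg
    refine ⟨Finset.mem_univ _, ?_, ?_⟩
    · rw [standardFace_isContained_iff]
      intro i
      refine ⟨_, List.mem_map.2 ⟨g i, List.mem_finRange _, rfl⟩, fun j hj => ?_⟩
      simp only [Finset.mem_filter, Finset.mem_univ, true_and]
      rw [changeSet_subset_iff_blockStart] at hc
      exact hc _ _ hj
    · ext1
      rw [← α.ofFn_blocksFun, List.ofFn_eq_map]
      simp only [Face.type, Face.ofKey, List.map_map]
      refine List.map_congr_left fun a _ => ?_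
      rw [← card_fiber_index α a, ← exists_perm_comp_eq_iff.1 hg a]
      rfl
  · intro g _ g' _ h
    have h' := congrArg Face.blocks h
    simp only [Face.ofKey] at h'
    rw [List.map_inj_left] at h'
    ext i : 1
    have := h' (g i) (List.mem_finRange _)
    have hi : i ∈ Finset.univ.filter fun j => g j = g i := by simp
    rw [this, Finset.mem_filter] at hi
    exact hi.2.symm
  -- The preimage of G sends i to the index of the unique block containing i.
  · intro G hG
    simp only [Finset.mem_filter, Finset.mem_univ, true_and] at hG
    obtain ⟨hc, rfl⟩ := hG
    have hlen : G.type.length = G.blocks.length := by simp [Face.type, Composition.length]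
    have hmem : ∀ i : Fin n, ∃ a : Fin G.type.length, i ∈ G.blocks[a.1]'(hlen ▸ a.2) := by
      intro i
      obtain ⟨b, hb, hi⟩ := G.cover i
      obtain ⟨m, hm, rfl⟩ := List.getElem_of_mem hb
      exact ⟨⟨m, hlen ▸ hm⟩, hi⟩
    have huniq : ∀ (i : Fin n) (a b : Fin G.type.length), i ∈ G.blocks[a.1]'(hlen ▸ a.2) →
        i ∈ G.blocks[b.1]'(hlen ▸ b.2) → a = b := by
      intro i a b ha hb
      have hd := List.pairwise_iff_getElem.1 G.disjoint
      rcases lt_trichotomy a b with h | h | h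
      · exact absurd hb (Finset.disjoint_left.1 (hd _ _ _ _ h) ha)
      · exact h
      · exact absurd ha (Finset.disjoint_left.1 (hd _ _ _ _ h) hb)
    choose g hg using hmem
    have hfib : ∀ a : Fin G.type.length,
        (Finset.univ.filter fun i => g i = a) = G.blocks[a.1]'(hlen ▸ a.2) := by
      intro a
      ext i
      simp only [Finset.mem_filter, Finset.mem_univ, true_and]
      constructor
      · rintro rfl
        exact hg i
      · intro hi
        exact huniq i _ _ (hg i) hi
    have hperm : ∃ σ : Perm (Fin n), g = G.type.index ∘ σ := by
      rw [exists_perm_comp_eq_iff]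
      intro a
      rw [card_fiber_index, hfib]
      exact (List.getElem_map (l := G.blocks) Finset.card).symm
    refine ⟨g, ?_, ?_⟩
    · rw [hS, Finset.mem_filter]
      refine ⟨Finset.mem_univ _, hperm, ?_⟩
      rw [changeSet_subset_iff_blockStart]
      intro i j hij
      rw [standardFace_isContained_iff] at hc
      obtain ⟨c, hc, hcj⟩ := hc i
      obtain ⟨m, hm, rfl⟩ := List.getElem_of_mem hc
      rw [huniq i _ ⟨m, hlen ▸ hm⟩ (hg i) (hcj i rfl),
        huniq j _ ⟨m, hlen ▸ hm⟩ (hg j) (hcj j hij.symm)]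
    · ext1
      simp only [Face.ofKey]
      refine List.ext_getElem (by simp [hlen]) fun m h1 h2 => ?_
      simp [hfib]

theorem sign_mul_constCount_mem (α : Composition n) {J : Finset ℕ} (hJ : J ⊆ Finset.Ico 1 n) :
    (-1) ^ (Finset.Ico 1 n \ J).card * (constCount α.index J : ℤ) ∈ signedKnapsackNumbers α := by
  -- For n = 0 the only face is empty, whereas a standard face always has a block starting at
  -- position 0.
  rcases Nat.eq_zero_or_pos n with rfl | hn
  · obtain rfl : J = ∅ := by simpa using hJ
    have h1 : ∀ F : Face 0, F.blocks = [] := fun F =>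
      List.eq_nil_iff_forall_not_mem.2 fun b hb => (F.nonempty b hb).elim fun i _ => i.elim0
    have h2 : ∀ β : Composition 0, β = α := fun β => by
      have hb : ∀ γ : Composition 0, γ.blocks = [] := fun γ =>
        List.length_eq_zero_iff.1 (Nat.le_zero.1 γ.length_le)
      ext1
      rw [hb, hb]
    have h3 : knapsack α ⟨[], by simp, by simp, fun i => i.elim0⟩ = 1 := by
      rw [knapsack, Finset.card_eq_one]
      refine ⟨⟨[], by simp, by simp, fun i => i.elim0⟩, ?_⟩
      ext F
      simp [h2, Face.IsContained, Face.ext_iff, h1]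
    have h4 : constCount α.index ∅ = 1 := by
      rw [constCount, Finset.card_eq_one]
      refine ⟨α.index, ?_⟩
      ext g
      have hg : g = α.index := Subsingleton.elim _ _
      subst hg
      simp only [Finset.mem_filter, Finset.mem_univ, true_and, Finset.mem_singleton, iff_true]
      exact ⟨⟨1, rfl⟩, by simp [changeSet]⟩
    refine Finset.mem_image.2 ⟨⟨[], by simp, by simp, fun i => i.elim0⟩, Finset.mem_univ _, ?_⟩
    rw [signedKnapsack, h3, h4]
    simp
  · refine Finset.mem_image.2 ⟨standardFace hn J hJ, Finset.mem_univ _, ?_⟩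
    rw [signedKnapsack, knapsack_standardFace, length_standardFace,
      Finset.card_sdiff_of_subset hJ, Nat.card_Ico]
    congr 2
    omega

end Faces

end ReverseShuffle

namespace ReverseShuffle

open Equiv Polynomial

/-! ### Annihilating polynomials -/

section Annihilation

variable {n : ℕ}

theorem sdiff_ssubset_sdiff_left {ι : Type*} [DecidableEq ι] {J K U : Finset ι} (hK : K ⊆ U)
    (h : J ⊂ K) : U \ K ⊂ U \ J := by
  refine ⟨Finset.sdiff_subset_sdiff subset_rfl h.1, fun h' => h.2 fun x hxK => ?_⟩
  by_contra hxJ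
  exact (Finset.mem_sdiff.1 (h' (Finset.mem_sdiff.2 ⟨hK hxK, hxJ⟩))).2 hxK

theorem basisB_eq (k : Type*) [CommRing k] (α : Composition n) :
    basisB k α = basisBSet k n (changeSet α.index) := by
  rw [basisB, partialSums_eq_changeSet]

/-- A polynomial multiple of an annihilator is an annihilator. -/
theorem aeval_mul_eq_zero_of_dvd {R B : Type*} [CommRing R] [Ring B] [Algebra R B] {p q : R[X]}
    (h : p ∣ q) {y x : B} (hp : aeval y p * x = 0) : aeval y q * x = 0 := by
  obtain ⟨r, rfl⟩ := h
  rw [mul_comm, map_mul, mul_assoc, hp, mul_zero]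

open Classical in
/-- The product rule, with the leading terms separated. -/
theorem basisBSet_changeSet_mul_eq_add {A : Type*} [LinearOrder A] [Fintype A] (k : Type*)
    [CommRing k] {g₀ : Fin n → A} (hg₀ : Monotone g₀) {J : Finset ℕ} :
    basisBSet k n (changeSet g₀) * basisBSet k n J =
      (constCount g₀ J : MonoidAlgebra k (Perm (Fin n))) * basisBSet k n J +
        ∑ g : Fin n → A with IsMonotoneRearrangement g₀ J g ∧ ¬ changeSet g ⊆ J,
          basisBSet k n (J ∪ changeSet g) := by
  rw [basisBSet_changeSet_mul k hg₀, ← Finset.sum_filter_add_sum_filter_not _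
    (fun g => changeSet g ⊆ J), Finset.filter_filter, Finset.filter_filter]
  congr 1
  have h : (Finset.univ.filter fun g : Fin n → A => IsMonotoneRearrangement g₀ J g ∧
      changeSet g ⊆ J) =
      Finset.univ.filter fun g : Fin n → A => (∃ σ : Perm (Fin n), g = g₀ ∘ σ) ∧
        changeSet g ⊆ J := by
    ext g
    rw [Finset.mem_filter, Finset.mem_filter]
    refine and_congr_right fun _ => ⟨fun h => ⟨h.1.1, h.2⟩, fun h => ⟨⟨h.1, fun i hi hJ => ?_⟩, h.2⟩⟩
    exact (changeSet_subset_iff.1 h.2 i hi hJ).le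
  rw [h, Finset.sum_congr rfl (g := fun _ => basisBSet k n J), Finset.sum_const, nsmul_eq_mul]
  · congr!
  · intro g hg
    rw [Finset.union_eq_left.2 (Finset.mem_filter.1 hg).2.2]

/-- The product over the signed knapsack numbers of absolute value at least `m`. -/
noncomputable def truncatedPolynomial (α : Composition n) (m : ℕ) : ℤ[X] :=
  ∏ z ∈ signedKnapsackNumbers α with m ≤ z.natAbs, (X - C z)

theorem truncatedPolynomial_dvd (α : Composition n) {m m' : ℕ} (h : m ≤ m') :
    truncatedPolynomial α m' ∣ truncatedPolynomial α m := by
  refine Finset.prod_dvd_prod_of_subset _ _ _ fun z hz => ?_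
  rw [Finset.mem_filter] at hz ⊢
  exact ⟨hz.1, h.trans hz.2⟩

/-- The factor x - z is absent from the product over larger absolute values. Only divisibility holds
in general, since -z may also be a signed knapsack number. -/
theorem truncatedPolynomial_succ_mul_dvd (α : Composition n) {z : ℤ}
    (hz : z ∈ signedKnapsackNumbers α) :
    truncatedPolynomial α (z.natAbs + 1) * (X - C z) ∣ truncatedPolynomial α z.natAbs := by
  have hn : z ∉ (signedKnapsackNumbers α).filter fun x => z.natAbs + 1 ≤ x.natAbs := by simp
  rw [truncatedPolynomial, mul_comm, ← Finset.prod_insert (f := fun z : ℤ => (X - C z : ℤ[X])) hn]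
  refine Finset.prod_dvd_prod_of_subset _ _ _ fun x hx => ?_
  rw [Finset.mem_insert] at hx
  rw [Finset.mem_filter]
  rcases hx with rfl | hx
  · exact ⟨hz, le_rfl⟩
  · rw [Finset.mem_filter] at hx
    exact ⟨hx.1, by omega⟩

/-- Truncation is by absolute value because N is monotone in J while the sign ε is not controlled.
The induction is on |U∖J|. -/
theorem aeval_truncatedPolynomial_mul_basisBSet (α : Composition n) {J : Finset ℕ}
    (hJ : J ⊆ Finset.Ico 1 n) :
    aeval (longestWord ℤ n * basisB ℤ α) (truncatedPolynomial α (constCount α.index J)) *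
      basisBSet ℤ n J = 0 := by
  classical
  set w := longestWord ℤ n with hw
  set b := basisB ℤ α with hb
  set N := constCount α.index with hN
  have hww : w * w = 1 := longestWord_mul_self ℤ n
  induction hm : (Finset.Ico 1 n \ J).card using Nat.strong_induction_on generalizing J with
  | _ m ih =>
  subst hm
  have ih' : ∀ K, J ⊂ K → K ⊆ Finset.Ico 1 n →
      aeval (w * b) (truncatedPolynomial α (N K)) * basisBSet ℤ n K = 0 := by
    intro K hJK hK
    refine ih _ (Finset.card_lt_card ?_) hK rfl
    exact sdiff_ssubset_sdiff_left hK hJK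
  have hhigh : ∀ g : Fin n → Fin α.length, (∃ σ : Perm (Fin n), g = α.index ∘ σ) →
      ¬ changeSet g ⊆ J →
      aeval (w * b) (truncatedPolynomial α (N J + 1)) * basisBSet ℤ n (J ∪ changeSet g) = 0 ∧
      aeval (w * b) (truncatedPolynomial α (N J + 1)) * (w * basisBSet ℤ n (J ∪ changeSet g)) = 0 := by
    intro g hg hgJ
    have hlt : N J < N (J ∪ changeSet g) := constCount_lt hg hgJ
    have hss : J ⊂ J ∪ changeSet g :=
      Finset.ssubset_iff_subset_ne.2 ⟨Finset.subset_union_left, fun h =>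
        hgJ (Finset.union_eq_left.1 h.symm)⟩
    have hsub : J ∪ changeSet g ⊆ Finset.Ico 1 n :=
      Finset.union_subset hJ (changeSet_subset_Ico g)
    have hK : ∀ K, J ∪ changeSet g ⊆ K → K ⊆ Finset.Ico 1 n →
        aeval (w * b) (truncatedPolynomial α (N J + 1)) * basisBSet ℤ n K = 0 := by
      intro K h1 h2
      exact aeval_mul_eq_zero_of_dvd
        (truncatedPolynomial_dvd α (Nat.succ_le_of_lt (hlt.trans_le (constCount_mono _ h1))))
        (ih' K (hss.trans_subset h1) h2)
    refine ⟨hK _ subset_rfl hsub, ?_⟩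
    -- All terms of w₀ B_K have index sets containing K, so their counts still exceed N(J).
    rw [hw, longestWord_mul_basisBSet, Finset.mul_sum]
    refine Finset.sum_eq_zero fun L hL => ?_
    rw [Finset.mem_powerset] at hL
    have hcomm : ((-1) ^ L.card : MonoidAlgebra ℤ (Perm (Fin n))) *
        basisBSet ℤ n (Finset.Ico 1 n \ L) =
        ((-1) ^ L.card : ℤ) • basisBSet ℤ n (Finset.Ico 1 n \ L) := by
      simp [zsmul_eq_mul]
    rw [hcomm, mul_smul_comm, hK _ ?_ Finset.sdiff_subset, smul_zero]
    rw [Finset.subset_sdiff]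
    exact ⟨hsub, (Finset.disjoint_of_subset_left hL Finset.sdiff_disjoint).symm⟩
  set ε : ℤ := (-1) ^ (Finset.Ico 1 n \ J).card with hε
  have hεε : ε * ε = 1 := by rw [hε, ← mul_pow]; simp
  have hrev : w * b * w = basisBSet ℤ n (changeSet (Fin.rev ∘ α.index ∘ Fin.rev)) := by
    rw [changeSet_rev, hb, basisB_eq, hw, longestWord_mul_basisBSet_mul_longestWord]
  have hmono : Monotone (Fin.rev ∘ α.index ∘ Fin.rev : Fin n → Fin α.length) := fun i j hij =>
    Fin.rev_le_rev.2 (monotone_index α (Fin.rev_le_rev.2 hij))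
  have h1 := basisBSet_changeSet_mul_eq_add ℤ (monotone_index α) (J := J)
  have h2 := basisBSet_changeSet_mul_eq_add ℤ hmono (J := J)
  rw [constCount_rev, ← hrev] at h2
  rw [← basisB_eq] at h1
  set R₁ := ∑ g : Fin n → Fin α.length with IsMonotoneRearrangement α.index J g ∧ ¬ changeSet g ⊆ J,
    basisBSet ℤ n (J ∪ changeSet g) with hR₁
  set R₂ := ∑ g : Fin n → Fin α.length with
    IsMonotoneRearrangement (Fin.rev ∘ α.index ∘ Fin.rev) J g ∧ ¬ changeSet g ⊆ J,
    basisBSet ℤ n (J ∪ changeSet g) with hR₂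
  have hkill₁ : aeval (w * b) (truncatedPolynomial α (N J + 1)) * (w * R₁) = 0 := by
    rw [hR₁, Finset.mul_sum, Finset.mul_sum]
    refine Finset.sum_eq_zero fun g hg => ?_
    obtain ⟨-, hg, hgJ⟩ := Finset.mem_filter.1 hg
    exact (hhigh g hg.1 hgJ).2
  have hkill₂ : aeval (w * b) (truncatedPolynomial α (N J + 1)) * R₂ = 0 := by
    rw [hR₂, Finset.mul_sum]
    refine Finset.sum_eq_zero fun g hg => ?_
    obtain ⟨-, ⟨⟨σ, rfl⟩, -⟩, hgJ⟩ := Finset.mem_filter.1 hg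
    -- Undoing the outer reversal gives a rearrangement of `α.index` with the same change set.
    have := (hhigh (α.index ∘ (Fin.revPerm * σ : Perm (Fin n))) ⟨_, rfl⟩ (by
      rw [← changeSet_comp_of_injective Fin.rev_injective]
      exact hgJ)).1
    rw [← changeSet_comp_of_injective Fin.rev_injective] at this
    exact this
  -- Up to higher terms, w₀ B_α swaps B_J and w₀ B_J with factor N(J), so this combination is an
  -- eigenvector for ε N(J).
  have he : (w * b - ((ε * N J : ℤ) : MonoidAlgebra ℤ (Perm (Fin n)))) *
      (basisBSet ℤ n J + ε • (w * basisBSet ℤ n J)) = w * R₁ + ε • R₂ := by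
    have e1 : w * b * basisBSet ℤ n J = (N J : ℤ) • (w * basisBSet ℤ n J) + w * R₁ := by
      rw [mul_assoc, h1, mul_add, ← nsmul_eq_mul, mul_smul_comm, natCast_zsmul]
    have e2 : w * b * (w * basisBSet ℤ n J) = (N J : ℤ) • basisBSet ℤ n J + R₂ := by
      rw [← mul_assoc, h2, ← nsmul_eq_mul, natCast_zsmul]
    rw [sub_mul, ← zsmul_eq_mul, mul_add, mul_smul_comm, e1, e2]
    simp only [smul_add, smul_smul]
    rw [show ε * (N J : ℤ) * ε = N J by rw [mul_right_comm, hεε, one_mul]]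
    abel
  have hmem : ε * (N J : ℤ) ∈ signedKnapsackNumbers α := sign_mul_constCount_mem α hJ
  have habs : (ε * (N J : ℤ)).natAbs = N J := by simp [hε, Int.natAbs_mul, Int.natAbs_pow]
  have hdvd := truncatedPolynomial_succ_mul_dvd α hmem
  rw [habs] at hdvd
  have hkill : aeval (w * b) (truncatedPolynomial α (N J)) *
      (basisBSet ℤ n J + ε • (w * basisBSet ℤ n J)) = 0 := by
    refine aeval_mul_eq_zero_of_dvd hdvd ?_
    have : aeval (w * b) (X - C (ε * (N J : ℤ))) =
        w * b - ((ε * N J : ℤ) : MonoidAlgebra ℤ (Perm (Fin n))) := by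
      rw [map_sub, aeval_X, aeval_C, eq_intCast]
    rw [map_mul, this, mul_assoc, he, mul_add, mul_smul_comm, hkill₁, hkill₂, smul_zero, add_zero]
  have hexp : w * basisBSet ℤ n J = ε • basisBSet ℤ n J +
      ∑ L ∈ (Finset.Ico 1 n \ J).powerset.erase (Finset.Ico 1 n \ J),
        ((-1) ^ L.card : ℤ) • basisBSet ℤ n (Finset.Ico 1 n \ L) := by
    rw [hw, longestWord_mul_basisBSet, ← Finset.add_sum_erase _ _
      (Finset.mem_powerset_self (Finset.Ico 1 n \ J)), Finset.sdiff_sdiff_eq_self hJ]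
    simp [zsmul_eq_mul, hε]
  rw [hexp, smul_add, smul_smul, hεε, one_smul, ← add_assoc, ← two_smul ℤ, mul_add] at hkill
  -- Here N(K) ≥ N(J) is enough, since the factors with |z| = N(J) are now included.
  have hrest : aeval (w * b) (truncatedPolynomial α (N J)) * (ε •
      ∑ L ∈ (Finset.Ico 1 n \ J).powerset.erase (Finset.Ico 1 n \ J),
        ((-1) ^ L.card : ℤ) • basisBSet ℤ n (Finset.Ico 1 n \ L)) = 0 := by
    rw [mul_smul_comm, Finset.mul_sum, Finset.sum_eq_zero, smul_zero]
    intro L hL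
    rw [Finset.mem_erase, Finset.mem_powerset] at hL
    have hss : J ⊂ Finset.Ico 1 n \ L := by
      have := sdiff_ssubset_sdiff_left (U := Finset.Ico 1 n) Finset.sdiff_subset
        (Finset.ssubset_iff_subset_ne.2 ⟨hL.2, hL.1⟩)
      rwa [Finset.sdiff_sdiff_eq_self hJ] at this
    rw [mul_smul_comm, aeval_mul_eq_zero_of_dvd
      (truncatedPolynomial_dvd α (constCount_mono _ hss.1)) (ih' _ hss Finset.sdiff_subset),
      smul_zero]
  rw [hrest, add_zero, mul_smul_comm, two_smul] at hkill
  -- Cancelling the factor 2 uses integer coefficients; a general k may have 2-torsion.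
  refine MonoidAlgebra.ext (Finsupp.ext fun v => ?_)
  have := congrArg (fun x : MonoidAlgebra ℤ (Perm (Fin n)) => x.coeff v) hkill
  rw [MonoidAlgebra.coeff_add, Finsupp.add_apply, MonoidAlgebra.coeff_zero, Finsupp.zero_apply,
    add_self_eq_zero] at this
  rwa [MonoidAlgebra.coeff_zero, Finsupp.zero_apply]

theorem signedKnapsackPolynomial_eq_map (k : Type*) [CommRing k] (α : Composition n) :
    signedKnapsackPolynomial k α = (truncatedPolynomial α 0).map (algebraMap ℤ k) := by
  simp [signedKnapsackPolynomial, truncatedPolynomial, Polynomial.map_prod]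

theorem aeval_longestWord_mul_basisB (k : Type*) [CommRing k] (α : Composition n) :
    aeval (longestWord k n * basisB k α) (signedKnapsackPolynomial k α) = 0 := by
  have h0 := aeval_truncatedPolynomial_mul_basisBSet α (Finset.empty_subset _)
  rw [basisBSet_empty] at h0
  have h := aeval_mul_eq_zero_of_dvd (truncatedPolynomial_dvd α (Nat.zero_le _)) h0
  rw [mul_one] at h
  let φ : MonoidAlgebra ℤ (Perm (Fin n)) →ₐ[ℤ] MonoidAlgebra k (Perm (Fin n)) :=
    (MonoidAlgebra.mapRingHom _ (Int.castRingHom k)).toIntAlgHom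
  have hφ : ∀ w, φ (MonoidAlgebra.of ℤ _ w) = MonoidAlgebra.of k _ w := fun w => by
    change MonoidAlgebra.mapRingHom _ (Int.castRingHom k) (MonoidAlgebra.single w 1) =
      MonoidAlgebra.single w 1
    simp
  have hy : longestWord k n * basisB k α = φ (longestWord ℤ n * basisB ℤ α) := by
    simp only [longestWord, basisB, basisBSet, map_mul, map_sum, hφ]
  rw [signedKnapsackPolynomial_eq_map, aeval_map_algebraMap, hy, aeval_algHom_apply, h, map_zero]

/-- Since w₀² = 1, the elements B_α w₀ and w₀ B_α are conjugate by w₀. -/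
theorem aeval_basisB_mul_longestWord (k : Type*) [CommRing k] (α : Composition n) :
    aeval (basisB k α * longestWord k n) (signedKnapsackPolynomial k α) = 0 := by
  have hconj : ∀ p : k[X], aeval (basisB k α * longestWord k n) p =
      longestWord k n * aeval (longestWord k n * basisB k α) p * longestWord k n := by
    intro p
    induction p using Polynomial.induction_on with
    | C a =>
      rw [aeval_C, aeval_C, ← Algebra.commutes, mul_assoc, longestWord_mul_self, mul_one]
    | add p q hp hq => rw [map_add, map_add, hp, hq, mul_add, add_mul]
    | monomial m a h =>
      rw [pow_succ, ← mul_assoc, map_mul, h, map_mul _ _ X, aeval_X, aeval_X]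
      simp only [mul_assoc]
  rw [hconj, aeval_longestWord_mul_basisB, mul_zero, zero_mul]

theorem longestWord_mul_basisBSet_mem (k : Type*) [CommRing k] (J : Finset ℕ) :
    longestWord k n * basisBSet k n J ∈ descentAlgebra k n := by
  rw [longestWord_mul_basisBSet]
  refine Submodule.sum_mem _ fun L _ => ?_
  have : ((-1) ^ L.card : MonoidAlgebra k (Perm (Fin n))) * basisBSet k n (Finset.Ico 1 n \ L) =
      ((-1) ^ L.card : k) • basisBSet k n (Finset.Ico 1 n \ L) := by
    rw [Algebra.smul_def, map_pow, map_neg, map_one]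
  rw [this]
  exact Submodule.smul_mem _ _ (Submodule.subset_span ⟨_, Finset.sdiff_subset, rfl⟩)

theorem basisBSet_mul_longestWord_mem (k : Type*) [CommRing k] (J : Finset ℕ) :
    basisBSet k n J * longestWord k n ∈ descentAlgebra k n := by
  have h := longestWord_mul_basisBSet_mem (n := n) k (reverseSet n J)
  rwa [← longestWord_mul_basisBSet_mul_longestWord, ← mul_assoc, ← mul_assoc, longestWord_mul_self,
    one_mul] at h

end Annihilation

end ReverseShuffle

open ReverseShuffle
theorem mainTheorem3 (k : Type*) [CommRing k] (n : ℕ) (α : Composition n) :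
    longestWord k n * basisB k α ∈ descentAlgebra k n ∧
    basisB k α * longestWord k n ∈ descentAlgebra k n ∧
    Polynomial.aeval (longestWord k n * basisB k α) (signedKnapsackPolynomial k α) = 0 ∧
    Polynomial.aeval (basisB k α * longestWord k n) (signedKnapsackPolynomial k α) = 0 :=
  ⟨longestWord_mul_basisBSet_mem k _, basisBSet_mul_longestWord_mem k _,
    aeval_longestWord_mul_basisB k α, aeval_basisB_mul_longestWord k α⟩
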